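/- Conventions. A finite probability space $(X,p)$ is a finite set $X$ with a probability measure $p$ on it. A morphism $f:(X,p)\to(Y,q)$ is a stochastic map, i.e. a probability measure $f_x=(f_{yx})_{y\in Y}$ on $Y$ for every $x\in X$, such that $q_y=\sum_{x\in X}f_{yx}p_x$ for all $y\in Y$. With the composition $(g\circ f)_{zx}=\sum_{y}g_{zy}f_{yx}$ these form a category $\mathbf{FinPS}$. Let $(\bullet,1)$ be the one-point probability space, and let $!_p:(X,p)\to(\bullet,1)$ be the unique morphism (the shriek of $p$). The conditional entropy of $f:(X,p)\to(Y,q)$ is $H(f|p)=\sum_{x}p_xH(f_x)$, where $H(s)=-\sum_{y}s_y\log s_y$ is the Shannon entropy, with $0\log 0=0$. A composable pair $(X,p)\xrightarrow{f}(Y,q)\xrightarrow{g}(Z,r)$ is a.e. coalescable if there is a function $h:Z\times X\to Y$ (a mediator) such that $(g\circ f)_{zx}=g_{z\,h(z,x)}\,f_{h(z,x)\,x}$ for all $z\in Z$ and all $x\in X$ with $p_x\neq 0$. Given $(X,p)$ and morphisms $Q^x:(Y_x,q^x)\to(Y'_x,q'^x)$ for $x\in X$, the $p$-weighted convex sum $\bigoplus_{x\in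 X} p_xQ^x$ is the morphism from $\coprod_x Y_x$, with the measure equal to $p_xq^x$ on $Y_x$, to $\coprod_x Y'_x$, with the measure equal to $p_xq'^x$ on $Y'_x$, whose entry at $(z',z)$ is $Q^x_{z'z}$ if $z\in Y_x$ and $z'\in Y'_x$ for the same $x$, and $0$ otherwise. A sequence of morphisms $f_n:(X_n,p_n)\to(Y_n,q_n)$ converges to $f:(X,p)\to(Y,q)$ if $X_n=X$ and $Y_n=Y$ for all sufficiently large $n$, and $p_n\to p$ and $f_n\to f$ entrywise. Theorem. Let $F$ be a function assigning to every morphism $f$ of $\mathbf{FinPS}$ a non-negative real number $F(f)$, such that 1. (semi-functoriality) $F(g\circ f)=F(g)+F(f)$ for every a.e. coalescable pair $(X,p)\xrightarrow{f}(Y,q)\xrightarrow{g}(Z,r)$; 2. (convex linearity) $F\big(\bigoplus_{x\in X}p_xQ^x\big)=\sum_{x\in X}p_xF(Q^x)$ for all $(X,p)$ and all families of morphisms $(Q^x)_{x\in X}$; 3. (continuity) $F(f_n)\to F(f)$ whenever a sequence of morphisms $f_n$ converges to $f$; 4. $F(!_p)=0$ for every finite probability space $(X,p)$. Then $F$ is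 a non-negative multiple of conditional entropy: there is a constant $c\ge 0$ such that $F(f)=c\,H(f|p)$ for every morphism $f:(X,p)\to(Y,q)$ of $\mathbf{FinPS}$. Conversely, conditional entropy is non-negative and satisfies conditions 1-4. -/

import Mathlib

open CategoryTheory Filter Topology

universe u

noncomputable section

/-- An object `(X, p)`: a finite set `X` with a probability measure `p` on it. -/
structure FinPS : Type (u + 1) where
  carrier : Type u
  [fintype : Fintype carrier]
  prob : stdSimplex ℝ carrier

namespace FinPS

instance : CoeSort FinPS.{u} (Type u) := ⟨carrier⟩

instance (A : FinPS.{u}) : Fintype A := A.fintype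

/-- A morphism `(X, p) ⟶ (Y, q)`: a stochastic map assigning to each `x : X` a probability measure
`f_x` on `Y` (with `f_x y` the entry `f_{yx}`), such that `q_y = ∑ x, f_{yx} p_x` for all `y`. -/
@[ext]
structure Hom (A B : FinPS.{u}) : Type u where
  toFun : A → stdSimplex ℝ B
  map_prob : ∀ y : B, B.prob y = ∑ x : A, toFun x y * A.prob x

open Classical in
/-- The point mass at `x`. -/
def dirac {X : Type u} [Fintype X] (x : X) : stdSimplex ℝ X :=
  ⟨fun y => if x = y then 1 else 0, ite_eq_mem_stdSimplex ℝ x⟩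

/-- The composite of stochastic maps on one input: `(g ∘ f)_{zx} = ∑ y, g_{zy} f_{yx}`, where
`s = f_x`. -/
def bind {Y Z : Type u} [Fintype Y] [Fintype Z] (s : stdSimplex ℝ Y) (g : Y → stdSimplex ℝ Z) :
    stdSimplex ℝ Z :=
  ⟨fun z => ∑ y : Y, g y z * s y,
    fun z => Finset.sum_nonneg fun y _ => mul_nonneg ((g y).2.1 z) (s.2.1 y), by
    rw [Finset.sum_comm]
    simp_rw [← Finset.sum_mul]
    have h : ∀ y, ∑ z, g y z = 1 := fun y => (g y).2.2
    simp_rw [h, one_mul]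
    exact s.2.2⟩

theorem dirac_apply {X : Type u} [Fintype X] [DecidableEq X] (x y : X) :
    dirac x y = if x = y then (1 : ℝ) else 0 := by
  change (@ite ℝ (x = y) (Classical.propDecidable _) 1 0) = _
  congr

theorem bind_apply {Y Z : Type u} [Fintype Y] [Fintype Z] (s : stdSimplex ℝ Y)
    (g : Y → stdSimplex ℝ Z) (z : Z) : bind s g z = ∑ y : Y, g y z * s y := rfl

/-- The category of finite probability spaces and probability-preserving stochastic maps. -/
instance : Category FinPS.{u} where
  Hom := Hom
  id A :=
    { toFun := dirac
      map_prob := by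
        classical
        intro y
        simp [dirac_apply] }
  comp {A B C} f g :=
    { toFun := fun x => bind (f.toFun x) g.toFun
      map_prob := by
        intro z
        rw [g.map_prob]
        simp_rw [bind_apply, f.map_prob, Finset.mul_sum, Finset.sum_mul, mul_assoc]
        exact Finset.sum_comm }
  id_comp {A B} f := by
    classical
    apply Hom.ext
    funext x
    ext z
    simp [bind_apply, dirac_apply]
  comp_id {A B} f := by
    classical
    apply Hom.ext
    funext x
    ext z
    simp [bind_apply, dirac_apply]
  assoc {A B C D} f g h := by
    apply Hom.ext
    funext x
    ext z
    simp_rw [bind_apply, Finset.mul_sum, Finset.sum_mul, mul_assoc]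
    exact Finset.sum_comm

/-- The entry `f_{yx} = f_x(y)` of a morphism. -/
def entry {A B : FinPS.{u}} (f : A ⟶ B) (y : B) (x : A) : ℝ := Hom.toFun f x y

/-- The one-point probability space `(•, 1)`. -/
def point : FinPS.{u} where
  carrier := PUnit.{u + 1}
  prob := dirac PUnit.unit

/-- The shriek `!_p : (X, p) ⟶ (•, 1)`. -/
def shriek (A : FinPS.{u}) : A ⟶ point where
  toFun _ := dirac PUnit.unit
  map_prob := by
    classical
    intro y
    have h : ∑ x : A, A.prob x = 1 := A.prob.2.2
    rw [← Finset.mul_sum, h, mul_one]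
    rfl

/-- The `p`-weighted convex sum `⨁ p_x (Y_x, q^x)` of objects, carried by the disjoint union. -/
def convexSum (P : FinPS.{u}) (Y : P → FinPS.{u}) : FinPS.{u} where
  carrier := Σ x : P, Y x
  prob := ⟨fun z => P.prob z.1 * (Y z.1).prob z.2,
    fun z => mul_nonneg (P.prob.2.1 z.1) ((Y z.1).prob.2.1 z.2), by
    rw [Fintype.sum_sigma]
    simp_rw [← Finset.mul_sum]
    have h : ∀ x, ∑ y, (Y x).prob y = 1 := fun x => (Y x).prob.2.2
    simp_rw [h, mul_one]
    exact P.prob.2.2⟩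

open Classical in
/-- A probability measure on one summand `Y x`, extended by zero to the disjoint union. -/
def extendZero {X : Type u} [Fintype X] {Y : X → Type u} [∀ x, Fintype (Y x)] (x : X)
    (s : stdSimplex ℝ (Y x)) : stdSimplex ℝ (Σ x, Y x) :=
  ⟨fun z => if h : z.1 = x then s (h ▸ z.2) else 0, by
    intro z
    dsimp only
    split_ifs
    · exact s.2.1 _
    · exact le_rfl, by
    rw [Fintype.sum_sigma, Finset.sum_eq_single x]
    · simp
    · intro b _ hb
      simp [hb]
    · simp⟩

theorem extendZero_same {X : Type u} [Fintype X] {Y : X → Type u} [∀ x, Fintype (Y x)] (x : X)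
    (s : stdSimplex ℝ (Y x)) (y : Y x) : extendZero x s ⟨x, y⟩ = s y := by
  change (@dite ℝ (x = x) (Classical.propDecidable _) (fun h => s (h ▸ y)) fun _ => 0) = s y
  simp

theorem extendZero_ne {X : Type u} [Fintype X] {Y : X → Type u} [∀ x, Fintype (Y x)] {x x' : X}
    (h : x' ≠ x) (s : stdSimplex ℝ (Y x)) (y : Y x') : extendZero x s ⟨x', y⟩ = 0 := by
  change (@dite ℝ (x' = x) (Classical.propDecidable _) (fun h => s (h ▸ y)) fun _ => 0) = 0
  simp [h]

/-- The `p`-weighted convex sum `⨁ p_x Q^x` of morphisms: its entry at `(z', z)` is `Q^x_{z'z}` if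
`z'` and `z` both lie over `x`, and `0` if they lie over different indices. -/
def convexSumMap (P : FinPS.{u}) {Y Y' : P → FinPS.{u}} (Q : ∀ x, Y x ⟶ Y' x) :
    convexSum P Y ⟶ convexSum P Y' where
  toFun z := extendZero (Y := fun x => Y' x) z.1 ((Q z.1).toFun z.2)
  map_prob := by
    rintro ⟨x, y⟩
    change P.prob x * (Y' x).prob y = ∑ z : (Σ x : P, Y x),
      extendZero (Y := fun x => Y' x) z.1 ((Q z.1).toFun z.2) ⟨x, y⟩ *
        (P.prob z.1 * (Y z.1).prob z.2)
    rw [Fintype.sum_sigma, Finset.sum_eq_single x]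
    · rw [(Q x).map_prob, Finset.mul_sum]
      refine Finset.sum_congr rfl fun w _ => ?_
      rw [extendZero_same]
      ring
    · intro b _ hb
      refine Finset.sum_eq_zero fun w _ => ?_
      rw [extendZero_ne hb.symm, zero_mul]
    · simp

/-- A function on the morphisms of the category, with real values. -/
abbrev MorphismFunction : Type (u + 1) := ∀ ⦃A B : FinPS.{u}⦄, (A ⟶ B) → ℝ

/-- The values are non-negative. -/
def Nonnegative (F : MorphismFunction.{u}) : Prop :=
  ∀ ⦃A B : FinPS.{u}⦄ (f : A ⟶ B), 0 ≤ F f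

/-- A function `h : Z × X → Y` is a mediator for `(X, p) ⟶ (Y, q) ⟶ (Z, r)` if
`(g ∘ f)_{zx} = g_{z h(z,x)} f_{h(z,x) x}` for all `z` and all `x` with `p_x ≠ 0`. -/
def IsMediator {A B C : FinPS.{u}} (f : A ⟶ B) (g : B ⟶ C) (h : C × A → B) : Prop :=
  ∀ (z : C) (x : A), A.prob x ≠ 0 →
    entry (f ≫ g) z x = entry g z (h (z, x)) * entry f (h (z, x)) x

/-- A composable pair is a.e. coalescable if it admits a mediator. -/
def AECoalescable {A B C : FinPS.{u}} (f : A ⟶ B) (g : B ⟶ C) : Prop :=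
  ∃ h : C × A → B, IsMediator f g h

/-- `F (g ∘ f) = F g + F f` for every a.e. coalescable pair. -/
def SemiFunctorial (F : MorphismFunction.{u}) : Prop :=
  ∀ ⦃A B C : FinPS.{u}⦄ (f : A ⟶ B) (g : B ⟶ C), AECoalescable f g → F (f ≫ g) = F g + F f

/-- `F (⨁ p_x Q^x) = ∑ p_x F (Q^x)` for all weights and all families of morphisms. -/
def ConvexLinear (F : MorphismFunction.{u}) : Prop :=
  ∀ (P : FinPS.{u}) (Y Y' : P → FinPS.{u}) (Q : ∀ x, Y x ⟶ Y' x),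
    F (convexSumMap P Q) = ∑ x : P, P.prob x * F (Q x)

/-- Convergence of a sequence of morphisms `f_n : (X_n, p_n) ⟶ (Y_n, q_n)` to
`f : (X, p) ⟶ (Y, q)`: from some `N` on, `X_n = X` and `Y_n = Y`, so that `f_n` is a morphism
`g_n : (X, p_n) ⟶ (Y, q_n)`; and `p_n → p` and `f_n → f` (entrywise). -/
def Converges {A B : ℕ → FinPS.{u}} (f : ∀ n, A n ⟶ B n) {A' B' : FinPS.{u}} (f' : A' ⟶ B') :
    Prop :=
  ∃ (N : ℕ) (p : ℕ → stdSimplex ℝ A') (q : ℕ → stdSimplex ℝ B')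
    (g : ∀ n, FinPS.mk A' (p n) ⟶ FinPS.mk B' (q n)),
    (∀ n ≥ N, Arrow.mk (f n) = Arrow.mk (g n)) ∧
    Tendsto p atTop (𝓝 A'.prob) ∧
    ∀ (y : B') (x : A'), Tendsto (fun n => entry (g n) y x) atTop (𝓝 (entry f' y x))

/-- `F (f_n) → F f` whenever `f_n` converges to `f`. -/
def SeqContinuous (F : MorphismFunction.{u}) : Prop :=
  ∀ (A B : ℕ → FinPS.{u}) (f : ∀ n, A n ⟶ B n) (A' B' : FinPS.{u}) (f' : A' ⟶ B'),
    Converges f f' → Tendsto (fun n => F (f n)) atTop (𝓝 (F f'))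

/-- `F (!_p) = 0` for every finite probability space `(X, p)`. -/
def VanishesOnShriek (F : MorphismFunction.{u}) : Prop :=
  ∀ A : FinPS.{u}, F (shriek A) = 0

/-- The Shannon entropy `H(p) = - ∑ p_x log p_x`, where `0 log 0 = 0`. -/
def shannonEntropy {X : Type u} [Fintype X] (p : stdSimplex ℝ X) : ℝ :=
  -∑ x : X, p x * Real.log (p x)

/-- The conditional entropy `H(f | p) = ∑ p_x H(f_x)` of a morphism `f : (X, p) ⟶ (Y, q)`. -/
def condEntropy : MorphismFunction.{u} := fun A _ f =>
  ∑ x : A, A.prob x * shannonEntropy (Hom.toFun f x)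

end FinPS

end

/-! For the converse, coalescability makes each sum `∑ y, g_{zy} f_{yx}` collapse to a single term,
and `negMulLog` then splits over products. For the characterization, a deterministic map followed by
a shriek is a shriek, so semi-functoriality forces `F` to vanish on deterministic maps. Every `f` is
a convex sum of maps out of a point, framed by two deterministic maps, so `F f` is the average of
`F` on the measures `f_x` (`eq_sum_state`). On measures, semi-functoriality and convex linearity
give the chain rule (`state_convexSum`), and Faddeev's argument applies. The values on uniform
measures are additive under multiplication and their consecutive differences tend to zero, hence
they equal `c * log n` (`additive_eq_log`). Grouping a uniform measure into blocks settles positive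
rational measures, and continuity settles the rest. -/

noncomputable section

namespace FinPS

open Real

/-! ### Elementary facts on finite probability measures -/

section Simplex

variable {X : Type u} [Fintype X]

theorem simplex_nonneg (s : stdSimplex ℝ X) (x : X) : 0 ≤ s x := s.2.1 x

theorem simplex_sum (s : stdSimplex ℝ X) : ∑ x, s x = 1 := s.2.2

theorem simplex_le_one (s : stdSimplex ℝ X) (x : X) : s x ≤ 1 := by
  rw [← simplex_sum s]
  exact Finset.single_le_sum (fun y _ => simplex_nonneg s y) (Finset.mem_univ x)

theorem simplex_punit (s t : stdSimplex ℝ PUnit.{u + 1}) : s = t := by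
  have key : ∀ r : stdSimplex ℝ PUnit.{u + 1}, r PUnit.unit = 1 := fun r => by
    rw [← simplex_sum r, Fintype.sum_unique]
  ext x
  cases x
  rw [key, key]

theorem shannonEntropy_eq_sum (s : stdSimplex ℝ X) :
    shannonEntropy s = ∑ x, negMulLog (s x) := by
  simp [shannonEntropy, negMulLog]

theorem shannonEntropy_nonneg (s : stdSimplex ℝ X) : 0 ≤ shannonEntropy s := by
  rw [shannonEntropy_eq_sum]
  exact Finset.sum_nonneg fun x _ => negMulLog_nonneg (simplex_nonneg s x) (simplex_le_one s x)

theorem tendsto_simplex_apply {s : ℕ → stdSimplex ℝ X} {t : stdSimplex ℝ X}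
    (h : Tendsto s atTop (𝓝 t)) (x : X) : Tendsto (fun n => s n x) atTop (𝓝 (t x)) := by
  have h1 := (continuous_subtype_val.tendsto t).comp h
  exact (tendsto_pi_nhds.1 h1) x

end Simplex

/-! ### Conditional entropy satisfies the characterizing properties -/

theorem condEntropy_nonnegative : Nonnegative condEntropy.{u} := fun A _ _ =>
  Finset.sum_nonneg fun x _ =>
    mul_nonneg (simplex_nonneg A.prob x) (shannonEntropy_nonneg _)

/-- With a mediator, `z` determines `y` almost surely, so the entropy of `z` is that of the pair
`(y, z)`. -/
theorem shannonEntropy_bind_of_mediator {Y Z : Type u} [Fintype Y] [Fintype Z]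
    (s : stdSimplex ℝ Y) (g : Y → stdSimplex ℝ Z) (h : Z → Y)
    (hh : ∀ z, bind s g z = g (h z) z * s (h z)) :
    shannonEntropy (bind s g) = ∑ y, s y * shannonEntropy (g y) + shannonEntropy s := by
  classical
  have key : ∀ z, negMulLog (bind s g z) = ∑ y, negMulLog (g y z * s y) := by
    intro z
    have hnn : ∀ y, 0 ≤ g y z * s y := fun y =>
      mul_nonneg (simplex_nonneg _ _) (simplex_nonneg _ _)
    -- A sum of non-negative terms that equals one of its terms has all other terms zero.
    have hz : ∀ y, y ≠ h z → g y z * s y = 0 := by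
      have h1 := hh z
      rw [bind_apply, ← Finset.add_sum_erase _ _ (Finset.mem_univ (h z)), add_eq_left,
        Finset.sum_eq_zero_iff_of_nonneg fun y _ => hnn y] at h1
      intro y hy
      exact h1 y (by simp [hy])
    rw [hh z, Finset.sum_eq_single (h z)]
    · intro y _ hy
      rw [hz y hy, negMulLog_zero]
    · simp
  simp_rw [shannonEntropy_eq_sum, key, negMulLog_mul, Finset.mul_sum]
  rw [Finset.sum_comm]
  simp_rw [Finset.sum_add_distrib, ← Finset.sum_mul]
  simp

theorem condEntropy_semiFunctorial : SemiFunctorial condEntropy.{u} := by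
  rintro A B C f g ⟨h, hh⟩
  have key : ∀ x : A, A.prob x * shannonEntropy (Hom.toFun (f ≫ g) x) =
      A.prob x * ∑ y, Hom.toFun f x y * shannonEntropy (Hom.toFun g y) +
        A.prob x * shannonEntropy (Hom.toFun f x) := by
    intro x
    by_cases hx : A.prob x = 0
    · simp [hx]
    · rw [← mul_add]
      congr 1
      exact shannonEntropy_bind_of_mediator (Hom.toFun f x) (Hom.toFun g) (fun z => h (z, x))
        fun z => hh z x hx
  unfold condEntropy
  simp_rw [key, Finset.sum_add_distrib]
  congr 1
  have hq : ∀ y : B, B.prob y = ∑ x : A, Hom.toFun f x y * A.prob x := Hom.map_prob f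
  simp_rw [hq, Finset.mul_sum, Finset.sum_mul]
  rw [Finset.sum_comm]
  refine Finset.sum_congr rfl fun y _ => Finset.sum_congr rfl fun x _ => ?_
  ring

theorem shannonEntropy_extendZero {X : Type u} [Fintype X] {Y : X → Type u} [∀ x, Fintype (Y x)]
    (x : X) (s : stdSimplex ℝ (Y x)) : shannonEntropy (extendZero x s) = shannonEntropy s := by
  classical
  simp_rw [shannonEntropy_eq_sum]
  rw [Fintype.sum_sigma, Finset.sum_eq_single x]
  · simp_rw [extendZero_same]
  · intro b _ hb
    simp [extendZero_ne hb]
  · simp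

theorem condEntropy_convexLinear : ConvexLinear condEntropy.{u} := by
  intro P Y Y' Q
  change ∑ z : (Σ x : P, Y x), P.prob z.1 * (Y z.1).prob z.2 *
    shannonEntropy (extendZero (Y := fun x => Y' x) z.1 ((Q z.1).toFun z.2)) = _
  simp_rw [shannonEntropy_extendZero]
  rw [Fintype.sum_sigma]
  simp_rw [condEntropy, Finset.mul_sum, mul_assoc]

theorem condEntropy_seqContinuous : SeqContinuous condEntropy.{u} := by
  rintro A B f A' B' f' ⟨N, p, q, g, hfg, hp, hg⟩
  have h1 : Tendsto (fun n => condEntropy (g n)) atTop (𝓝 (condEntropy f')) := by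
    unfold condEntropy
    simp_rw [shannonEntropy_eq_sum]
    refine tendsto_finsetSum _ fun x _ => ?_
    refine (tendsto_simplex_apply hp x).mul (tendsto_finsetSum _ fun y _ => ?_)
    exact (continuous_negMulLog.tendsto _).comp (hg y x)
  refine h1.congr' ?_
  filter_upwards [eventually_ge_atTop N] with n hn
  -- The endpoints agree only propositionally; equality of arrows carries the value across.
  exact (congrArg (fun a : Arrow FinPS.{u} => condEntropy a.hom) (hfg n hn)).symm

theorem condEntropy_vanishesOnShriek : VanishesOnShriek condEntropy.{u} := by
  classical
  intro A
  refine Finset.sum_eq_zero fun x _ => ?_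
  rw [shannonEntropy_eq_sum]
  change A.prob x * ∑ y : PUnit.{u + 1}, negMulLog (dirac PUnit.unit y) = 0
  simp

/-! ### Additive arithmetic functions -/

/-- A completely additive function whose consecutive differences tend to zero is a multiple of the
logarithm. -/
theorem additive_eq_log {φ : ℕ → ℝ}
    (hmul : ∀ m n, 0 < m → 0 < n → φ (m * n) = φ m + φ n)
    (hdiff : Tendsto (fun n => φ (n + 1) - φ n) atTop (𝓝 0)) {n : ℕ} (hn : 0 < n) :
    φ n = φ 2 / log 2 * log n := by
  have hlog2 : (0 : ℝ) < log 2 := log_pos one_lt_two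
  set c := φ 2 / log 2 with hc
  -- The defect `g` inherits additivity and vanishing differences, and `g 2 = 0` by the choice of
  -- `c`; the goal is `g n = 0`.
  let g : ℕ → ℝ := fun n => φ n - c * log n
  have gmul : ∀ m n, 0 < m → 0 < n → g (m * n) = g m + g n := by
    intro m n hm hn
    have hm' : (m : ℝ) ≠ 0 := by positivity
    have hn' : (n : ℝ) ≠ 0 := by positivity
    simp only [g]
    rw [hmul m n hm hn, Nat.cast_mul, log_mul hm' hn']
    ring
  have g2 : g 2 = 0 := by
    simp only [g, hc]
    push_cast
    field_simp
    ring
  have g1 : g 1 = 0 := by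
    have := gmul 1 1 one_pos one_pos
    simp at this
    exact this
  have gpow : ∀ k : ℕ, g (n ^ k) = k * g n := by
    intro k
    induction k with
    | zero => simp [g1]
    | succ k ih =>
      rw [pow_succ, gmul _ _ (pow_pos hn k) hn, ih]
      push_cast
      ring
  have gdiff : Tendsto (fun n => g (n + 1) - g n) atTop (𝓝 0) := by
    have h1 := hdiff.sub ((tendsto_log_nat_add_one_sub_log).const_mul c)
    simp only [mul_zero, sub_zero] at h1
    refine h1.congr fun n => ?_
    simp only [g]
    push_cast
    ring
  have bound : ∀ ε > 0, |g n| ≤ ε * n := by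
    intro ε hε
    obtain ⟨N, hN⟩ := (Metric.tendsto_atTop.1 gdiff) ε hε
    simp only [Real.dist_eq, sub_zero] at hN
    let C := ∑ i ∈ Finset.range (N + 2), |g i|
    have hC : 0 ≤ C := Finset.sum_nonneg fun i _ => abs_nonneg _
    -- Halving `m` costs at most one small difference, since `g (2 * j) = g j`, and there are about
    -- `log₂ m` halvings before the finite range bounded by `C`.
    have growth : ∀ m : ℕ, 0 < m → |g m| ≤ C + ε * (Nat.log 2 m : ℕ) := by
      intro m
      induction m using Nat.strong_induction_on with
      | _ m ih =>
        intro hm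
        by_cases hmN : m < N + 2
        · have h1 : |g m| ≤ C :=
            Finset.single_le_sum (f := fun i => |g i|) (fun i _ => abs_nonneg _)
              (Finset.mem_range.2 hmN)
          have : 0 ≤ ε * (Nat.log 2 m : ℕ) := by positivity
          linarith
        · have hj : 0 < m / 2 := by omega
          have h1 := ih (m / 2) (by omega) hj
          have hlog : Nat.log 2 m = Nat.log 2 (m / 2) + 1 := by
            rw [Nat.log_of_one_lt_of_le one_lt_two (by omega)]
          have hdouble : g (2 * (m / 2)) = g (m / 2) := by
            rw [gmul _ _ two_pos hj, g2, zero_add]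
          have h2 : |g m - g (m / 2)| ≤ ε := by
            rcases Nat.even_or_odd' m with ⟨k, hk | hk⟩
            · have : m = 2 * (m / 2) := by omega
              have heq : g m = g (m / 2) := by
                conv_lhs => rw [this]
                exact hdouble
              simp [heq, hε.le]
            · have : m = 2 * (m / 2) + 1 := by omega
              rw [← hdouble]
              have h3 := hN (2 * (m / 2)) (by omega)
              rw [← this] at h3
              exact h3.le
          rw [hlog]
          push_cast
          have h3 : |g m| ≤ |g m - g (m / 2)| + |g (m / 2)| := by
            simpa using abs_add_le (g m - g (m / 2)) (g (m / 2))
          linarith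
    -- Along powers `g (n ^ k)` is linear in `k`, so the constant `C` becomes negligible; `n < 2 ^
    -- n` gives a crude bound on the logarithm.
    have hk : ∀ k : ℕ, (k : ℝ) * (|g n| - ε * n) ≤ C := by
      intro k
      have h1 := growth (n ^ k) (pow_pos hn k)
      rw [gpow, abs_mul, Nat.abs_cast] at h1
      have h2 : Nat.log 2 (n ^ k) ≤ n * k := by
        calc Nat.log 2 (n ^ k) ≤ Nat.log 2 ((2 ^ n) ^ k) :=
              Nat.log_mono_right (Nat.pow_le_pow_left Nat.lt_two_pow_self.le k)
          _ = n * k := by rw [← pow_mul, Nat.log_pow one_lt_two]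
      have h3 : ((Nat.log 2 (n ^ k) : ℕ) : ℝ) ≤ n * k := by exact_mod_cast h2
      have h4 := mul_le_mul_of_nonneg_left h3 hε.le
      linarith
    by_contra! hlt
    obtain ⟨k, hk'⟩ := exists_nat_gt (C / (|g n| - ε * n))
    rw [div_lt_iff₀ (by linarith)] at hk'
    linarith [hk k]
  have hzero : |g n| ≤ 0 := by
    refine le_of_forall_pos_le_add fun ε hε => ?_
    have hn' : (0 : ℝ) < n := by exact_mod_cast hn
    have := bound (ε / n) (by positivity)
    rw [div_mul_cancel₀ _ hn'.ne'] at this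
    linarith
  have := abs_nonpos_iff.1 hzero
  simp only [g] at this
  linarith

/-! ### Morphism functions satisfying the characterizing properties -/

/-- The properties which characterize conditional entropy up to a factor. -/
structure IsInformationLoss (F : MorphismFunction.{u}) : Prop where
  nonneg : Nonnegative F
  semi : SemiFunctorial F
  convex : ConvexLinear F
  cont : SeqContinuous F
  shriek : VanishesOnShriek F

/-- The morphism from the one-point space given by a probability measure. -/
def state {X : Type u} [Fintype X] (s : stdSimplex ℝ X) : point.{u} ⟶ FinPS.mk X s where
  toFun _ := s
  map_prob y := by
    classical
    change s y = ∑ x : PUnit.{u + 1}, s y * dirac PUnit.unit x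
    simp

theorem entry_comp {A B C : FinPS.{u}} (f : A ⟶ B) (g : B ⟶ C) (z : C) (x : A) :
    entry (f ≫ g) z x = ∑ y, entry g z y * entry f y x := rfl

theorem hom_ext {A B : FinPS.{u}} {f g : A ⟶ B} (h : ∀ y x, entry f y x = entry g y x) :
    f = g := by
  apply Hom.ext
  funext x
  ext y
  exact h y x

theorem aecoalescable_of_dirac_left {A B C : FinPS.{u}} (f : A ⟶ B) (g : B ⟶ C) (e : A → B)
    (hf : ∀ x, Hom.toFun f x = dirac (e x)) : AECoalescable f g := by
  classical
  refine ⟨fun w => e w.2, fun z x _ => ?_⟩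
  rw [entry_comp]
  simp [entry, hf, dirac_apply]


/-! ### Deterministic maps, states and the chain rule -/

namespace IsInformationLoss

variable {F : MorphismFunction.{u}}

/-- Semi-functoriality applied to `f` followed by the shriek of `B`, which is the shriek of `A`,
leaves only `F f`. -/
theorem eq_zero_of_dirac (hF : IsInformationLoss F) {A B : FinPS.{u}} (f : A ⟶ B) (e : A → B)
    (hf : ∀ x, Hom.toFun f x = dirac (e x)) : F f = 0 := by
  have h : f ≫ FinPS.shriek B = FinPS.shriek A := by
    apply Hom.ext
    funext x
    exact simplex_punit _ _
  have h1 := hF.semi f (FinPS.shriek B) (aecoalescable_of_dirac_left f _ e hf)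
  rw [h, hF.shriek, hF.shriek] at h1
  linarith

theorem state_dirac (hF : IsInformationLoss F) {X : Type u} [Fintype X] (x : X) :
    F (state (dirac x)) = 0 :=
  hF.eq_zero_of_dirac _ (fun _ => x) fun _ => rfl

/-- Relabelling is composition with a deterministic bijection, whose inverse provides the mediator.
-/
theorem state_equiv (hF : IsInformationLoss F) {X Y : Type u} [Fintype X] [Fintype Y] (e : X ≃ Y)
    {s : stdSimplex ℝ X} {t : stdSimplex ℝ Y} (h : ∀ x, t (e x) = s x) :
    F (state t) = F (state s) := by
  classical
  let m : FinPS.mk X s ⟶ FinPS.mk Y t :=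
    { toFun := fun x => dirac (e x)
      map_prob := by
        intro y
        obtain ⟨x, rfl⟩ := e.surjective y
        change t (e x) = ∑ x' : X, dirac (e x') (e x) * s x'
        simp [dirac_apply, h] }
  have hentry : ∀ z x, entry m z x = if e x = z then 1 else 0 := fun z x => dirac_apply _ _
  have hcomp : ∀ z x, entry (state s ≫ m) z x = s (e.symm z) := by
    intro z x
    change ∑ x' : X, dirac (e x') z * s x' = _
    rw [Finset.sum_eq_single (e.symm z)]
    · simp [dirac_apply]
    · intro b _ hb
      have : e b ≠ z := fun h => hb (by simp [← h])
      simp [dirac_apply, this]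
    · simp
  have h1 : state s ≫ m = state t := by
    refine hom_ext fun z x => ?_
    rw [hcomp, ← h, e.apply_symm_apply]
    rfl
  have h2 : AECoalescable (state s) m := by
    refine ⟨fun w => e.symm w.1, fun z x _ => ?_⟩
    rw [hcomp, hentry]
    simp only [Equiv.apply_symm_apply, if_true, one_mul]
    rfl
  have h3 := hF.semi _ _ h2
  rw [h1, hF.eq_zero_of_dirac m e fun _ => rfl] at h3
  linarith

theorem state_tendsto (hF : IsInformationLoss F) {X : Type u} [Fintype X]
    {s : ℕ → stdSimplex ℝ X} {t : stdSimplex ℝ X} (h : Tendsto s atTop (𝓝 t)) :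
    Tendsto (fun n => F (state (s n))) atTop (𝓝 (F (state t))) := by
  refine hF.cont (fun _ => point) (fun n => FinPS.mk X (s n)) (fun n => state (s n)) _ _ _
    ⟨0, fun _ => point.prob, s, fun n => state (s n), fun _ _ => rfl, tendsto_const_nhds, ?_⟩
  intro y _
  exact tendsto_simplex_apply h y

/-- The chain rule. -/
theorem state_convexSum (hF : IsInformationLoss F) (P : FinPS.{u}) (Y : P → FinPS.{u}) :
    F (state (convexSum P Y).prob) =
      F (state P.prob) + ∑ x : P, P.prob x * F (state (Y x).prob) := by
  classical
  let Q : ∀ x : P, point.{u} ⟶ Y x := fun x => state (Y x).prob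
  let i : point.{u} ⟶ convexSum P (fun _ => point) := state (convexSum P fun _ => point).prob
  have hi : F i = F (state P.prob) := by
    refine hF.state_equiv (Equiv.sigmaPUnit P.carrier).symm fun x => ?_
    change P.prob x * dirac PUnit.unit PUnit.unit = P.prob x
    simp
  -- A point of the disjoint union remembers its summand, so only one intermediate point
  -- contributes; this is the mediator.
  have hcomp : ∀ (z : convexSum P Y) (w : point.{u}), entry (i ≫ convexSumMap P Q) z w =
      entry (convexSumMap P Q) z ⟨z.1, PUnit.unit⟩ * entry i ⟨z.1, PUnit.unit⟩ w := by
    rintro ⟨x, y⟩ w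
    change ∑ v : (Σ _ : P, PUnit.{u + 1}), entry (convexSumMap P Q) ⟨x, y⟩ v * entry i v w = _
    rw [Finset.sum_eq_single ⟨x, PUnit.unit⟩]
    · rfl
    · rintro ⟨x', _⟩ _ hne
      have hx : x ≠ x' := by
        rintro rfl
        exact hne rfl
      exact mul_eq_zero_of_left (extendZero_ne hx _ _) _
    · exact fun h => absurd (Finset.mem_univ _) h
  have h1 : i ≫ convexSumMap P Q = state (convexSum P Y).prob := by
    refine hom_ext fun z w => ?_
    rw [hcomp]
    obtain ⟨x, y⟩ := z
    have e1 : entry (convexSumMap P Q) ⟨x, y⟩ ⟨x, PUnit.unit⟩ = (Y x).prob y :=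
      extendZero_same _ _ _
    have e2 : entry i ⟨x, PUnit.unit⟩ w = P.prob x := by
      change P.prob x * dirac PUnit.unit PUnit.unit = P.prob x
      simp
    rw [e1, e2, mul_comm]
    rfl
  have h2 : AECoalescable i (convexSumMap P Q) :=
    ⟨fun w => ⟨w.1.1, PUnit.unit⟩, fun z x _ => hcomp z x⟩
  rw [← h1, hF.semi _ _ h2, hF.convex, hi, add_comm]

/-- The value on a morphism is the average of the values on its conditional distributions. -/
theorem eq_sum_state (hF : IsInformationLoss F) {A B : FinPS.{u}} (f : A ⟶ B) :
    F f = ∑ x : A, A.prob x * F (state (Hom.toFun f x)) := by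
  classical
  let Y : A → FinPS.{u} := fun x => FinPS.mk B (Hom.toFun f x)
  let Q : ∀ x : A, point.{u} ⟶ Y x := fun x => state (Hom.toFun f x)
  -- Factorization of `f`: `i` tags `x`, the convex sum of the states draws `y` from `f_x` while
  -- keeping `x`, and `r` forgets `x`.
  let i : A ⟶ convexSum A (fun _ => point) :=
    { toFun := fun x => dirac ⟨x, PUnit.unit⟩
      map_prob := by
        rintro ⟨x, y⟩
        change A.prob x * dirac PUnit.unit PUnit.unit =
          ∑ x' : A, dirac (X := Σ _ : A, PUnit.{u + 1}) ⟨x', PUnit.unit⟩ ⟨x, PUnit.unit⟩ * A.prob x'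
        simp [dirac_apply] }
  let r : convexSum A Y ⟶ B :=
    { toFun := fun z => dirac z.2
      map_prob := by
        intro y
        change B.prob y = ∑ z : (Σ _ : A, B), dirac z.2 y * (A.prob z.1 * Hom.toFun f z.1 z.2)
        rw [Fintype.sum_sigma, Hom.map_prob f]
        refine Finset.sum_congr rfl fun x _ => ?_
        simp [dirac_apply, mul_comm] }
  have hr : ∀ (z : B) (x : A), entry (convexSumMap A Q ≫ r) z ⟨x, PUnit.unit⟩ = entry f z x := by
    intro z x
    change ∑ v : (Σ _ : A, B), dirac v.2 z *
      extendZero (Y := fun _ : A => (B : Type u)) x (Hom.toFun f x) v = Hom.toFun f x z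
    rw [Fintype.sum_sigma, Finset.sum_eq_single x]
    · have : ∀ y : B, extendZero (Y := fun _ : A => (B : Type u)) x (Hom.toFun f x) ⟨x, y⟩ = Hom.toFun f x y :=
        fun y => extendZero_same (Y := fun _ : A => (B : Type u)) _ _ _
      simp only [this, dirac_apply]
      simp
    · intro b _ hb
      refine Finset.sum_eq_zero fun y _ => ?_
      rw [extendZero_ne (Y := fun _ : A => (B : Type u)) hb, mul_zero]
    · simp
  have h1 : i ≫ convexSumMap A Q ≫ r = f := by
    refine hom_ext fun z x => ?_
    rw [← hr, entry_comp, Finset.sum_eq_single ⟨x, PUnit.unit⟩]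
    · have : entry i ⟨x, PUnit.unit⟩ x = 1 := by
        change dirac (X := Σ _ : A, PUnit.{u + 1}) ⟨x, PUnit.unit⟩ ⟨x, PUnit.unit⟩ = 1
        simp [dirac_apply]
      rw [this, mul_one]
    · intro v _ hv
      have : entry i v x = 0 := by
        change dirac (X := Σ _ : A, PUnit.{u + 1}) ⟨x, PUnit.unit⟩ v = 0
        exact (dirac_apply (X := Σ _ : A, PUnit.{u + 1}) _ _).trans (if_neg hv.symm)
      rw [this, mul_zero]
    · exact fun h => absurd (Finset.mem_univ _) h
  have h2 : AECoalescable (convexSumMap A Q) r := by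
    -- Given the input `x` and the output `z`, the intermediate point can only be `(x, z)`.
    refine ⟨fun w => ⟨w.2.1, w.1⟩, fun z v _ => ?_⟩
    obtain ⟨x, v⟩ := v
    have e1 : entry r z ⟨x, z⟩ = 1 := by
      change dirac z z = 1
      simp [dirac_apply]
    have e2 : entry (convexSumMap A Q) ⟨x, z⟩ ⟨x, v⟩ = entry f z x := extendZero_same _ _ _
    change _ = entry r z ⟨x, z⟩ * entry (convexSumMap A Q) ⟨x, z⟩ ⟨x, v⟩
    rw [e1, e2, one_mul]
    exact hr z x
  have h3 := hF.semi i (convexSumMap A Q ≫ r)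
    (aecoalescable_of_dirac_left i _ (fun x => ⟨x, PUnit.unit⟩) fun _ => rfl)
  rw [h1, hF.eq_zero_of_dirac i (fun x => ⟨x, PUnit.unit⟩) (fun _ => rfl), hF.semi _ _ h2,
    hF.eq_zero_of_dirac r (fun z => z.2) (fun _ => rfl), hF.convex] at h3
  rw [h3]
  simp [Q]

end IsInformationLoss

/-! ### Uniform measures and the determination of the value on states -/

/-- The uniform measure. -/
def uniform (X : Type u) [Fintype X] [Nonempty X] : stdSimplex ℝ X :=
  ⟨fun _ => (Fintype.card X : ℝ)⁻¹, fun _ => by positivity, by simp⟩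

theorem uniform_apply (X : Type u) [Fintype X] [Nonempty X] (x : X) :
    uniform X x = (Fintype.card X : ℝ)⁻¹ := rfl

/-- The measure proportional to given positive integral weights. -/
def ofWeights {X : Type u} [Fintype X] [Nonempty X] (a : X → ℕ) (ha : ∀ x, 0 < a x) :
    stdSimplex ℝ X :=
  ⟨fun x => (a x : ℝ) / (∑ y, a y : ℕ), fun _ => by positivity, by
    have h : 0 < ∑ y, a y := Finset.sum_pos (fun y _ => ha y) Finset.univ_nonempty
    have h' : ((∑ y, a y : ℕ) : ℝ) ≠ 0 := by exact_mod_cast h.ne'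
    rw [← Finset.sum_div, ← Nat.cast_sum, div_self h']⟩

theorem ofWeights_apply {X : Type u} [Fintype X] [Nonempty X] (a : X → ℕ) (ha : ∀ x, 0 < a x)
    (x : X) : ofWeights a ha x = (a x : ℝ) / (∑ y, a y : ℕ) := rfl

/-- The counterpart for `log` and Shannon entropy of `uniformValue_sum`; comparing the two
determines `F` on integral weights. -/
theorem log_sum_eq {X : Type u} [Fintype X] [Nonempty X] (a : X → ℕ) (ha : ∀ x, 0 < a x) :
    log (∑ x, a x : ℕ) =
      shannonEntropy (ofWeights a ha) + ∑ x, ofWeights a ha x * log (a x) := by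
  have h : 0 < ∑ y, a y := Finset.sum_pos (fun y _ => ha y) Finset.univ_nonempty
  have h' : ((∑ y, a y : ℕ) : ℝ) ≠ 0 := by exact_mod_cast h.ne'
  have key : ∀ x, ofWeights a ha x * log (ofWeights a ha x) =
      ofWeights a ha x * log (a x) - ofWeights a ha x * log (∑ x, a x : ℕ) := by
    intro x
    have hx : (a x : ℝ) ≠ 0 := by exact_mod_cast (ha x).ne'
    conv_lhs => rw [ofWeights_apply, log_div hx h', ← ofWeights_apply a ha]
    ring
  unfold shannonEntropy
  simp_rw [key]
  rw [Finset.sum_sub_distrib, ← Finset.sum_mul, simplex_sum]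
  ring

theorem exists_tendsto_ofWeights {X : Type u} [Fintype X] [Nonempty X] (s : stdSimplex ℝ X) :
    ∃ (a : ℕ → X → ℕ) (ha : ∀ k x, 0 < a k x),
      Tendsto (fun k => ofWeights (a k) (ha k)) atTop (𝓝 s) := by
  -- The added `1` keeps the weights positive where `s` vanishes and is negligible after division by
  -- `k`.
  refine ⟨fun k x => ⌊s x * k⌋₊ + 1, fun k x => Nat.succ_pos _, ?_⟩
  have h1 : ∀ x, Tendsto (fun k : ℕ => ((⌊s x * k⌋₊ + 1 : ℕ) : ℝ) / k) atTop (𝓝 (s x)) := by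
    intro x
    have h2 := ((tendsto_nat_floor_mul_div_atTop (simplex_nonneg s x)).comp
      tendsto_natCast_atTop_atTop).add (tendsto_one_div_atTop_nhds_zero_nat (𝕜 := ℝ))
    rw [add_zero] at h2
    refine h2.congr fun k => ?_
    simp only [Function.comp_apply]
    push_cast
    rw [add_div]
  have h3 : Tendsto (fun k : ℕ => ((∑ x, (⌊s x * k⌋₊ + 1) : ℕ) : ℝ) / k) atTop (𝓝 1) := by
    have h4 := tendsto_finsetSum Finset.univ fun x _ => h1 x
    rw [simplex_sum] at h4
    refine h4.congr fun k => ?_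
    rw [← Finset.sum_div, Nat.cast_sum]
  refine tendsto_subtype_rng.2 (tendsto_pi_nhds.2 fun x => ?_)
  have h5 := (h1 x).div h3 one_ne_zero
  rw [div_one] at h5
  refine h5.congr' ?_
  filter_upwards [eventually_gt_atTop 0] with k hk
  have hk' : (k : ℝ) ≠ 0 := by exact_mod_cast hk.ne'
  exact div_div_div_cancel_right₀ hk' _ _

theorem tendsto_shannonEntropy {X : Type u} [Fintype X] {s : ℕ → stdSimplex ℝ X}
    {t : stdSimplex ℝ X} (h : Tendsto s atTop (𝓝 t)) :
    Tendsto (fun n => shannonEntropy (s n)) atTop (𝓝 (shannonEntropy t)) := by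
  simp_rw [shannonEntropy_eq_sum]
  exact tendsto_finsetSum _ fun x _ =>
    (continuous_negMulLog.tendsto _).comp (tendsto_simplex_apply h x)

/-- The value on the uniform measure on `n` points, for positive `n`. -/
def uniformValue (F : MorphismFunction.{u}) (n : ℕ) : ℝ :=
  -- `n - 1 + 1` keeps the type nonempty; it equals `n` except at `n = 0`, where it gives one point.
  F (state (uniform (ULift.{u} (Fin (n - 1 + 1)))))

namespace IsInformationLoss

variable {F : MorphismFunction.{u}}

theorem state_uniform (hF : IsInformationLoss F) (X : Type u) [Fintype X] [Nonempty X] :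
    F (state (uniform X)) = uniformValue F (Fintype.card X) := by
  have hpos : 0 < Fintype.card X := Fintype.card_pos
  have hcard : Fintype.card (ULift.{u} (Fin (Fintype.card X - 1 + 1))) = Fintype.card X := by
    simp only [Fintype.card_ulift, Fintype.card_fin]
    omega
  refine hF.state_equiv (Fintype.equivOfCardEq hcard) fun x => ?_
  rw [uniform_apply, uniform_apply, hcard]

/-- Chain rule for a uniform measure cut into blocks of sizes `a x`, each again uniform. -/
theorem uniformValue_sum (hF : IsInformationLoss F) {X : Type u} [Fintype X] [Nonempty X]
    (a : X → ℕ) (ha : ∀ x, 0 < a x) :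
    uniformValue F (∑ x, a x) =
      F (state (ofWeights a ha)) + ∑ x, ofWeights a ha x * uniformValue F (a x) := by
  have : ∀ x, Nonempty (ULift.{u} (Fin (a x))) := fun x => ⟨⟨⟨0, ha x⟩⟩⟩
  have : Nonempty (Σ x : X, ULift.{u} (Fin (a x))) :=
    ⟨⟨Classical.arbitrary X, Classical.arbitrary _⟩⟩
  let P : FinPS.{u} := FinPS.mk X (ofWeights a ha)
  let Y : P → FinPS.{u} := fun x => FinPS.mk (ULift.{u} (Fin (a x))) (uniform _)
  have hcard : Fintype.card (Σ x : X, ULift.{u} (Fin (a x))) = ∑ x, a x := by simp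
  have h1 : (convexSum P Y).prob = uniform (Σ x : X, ULift.{u} (Fin (a x))) := by
    ext ⟨x, y⟩
    have hx : (a x : ℝ) ≠ 0 := by exact_mod_cast (ha x).ne'
    change (a x : ℝ) / (∑ y, a y : ℕ) * (Fintype.card (ULift.{u} (Fin (a x))) : ℝ)⁻¹ =
      (Fintype.card (Σ x : X, ULift.{u} (Fin (a x))) : ℝ)⁻¹
    rw [hcard, Fintype.card_ulift, Fintype.card_fin]
    field_simp
  have h2 := hF.state_convexSum P Y
  have h3 : F (state (convexSum P Y).prob) = uniformValue F (∑ x, a x) := by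
    rw [h1, ← hcard]
    exact hF.state_uniform (Σ x : X, ULift.{u} (Fin (a x)))
  have h4 : ∀ x, F (state (Y x).prob) = uniformValue F (a x) := by
    intro x
    have := hF.state_uniform (ULift.{u} (Fin (a x)))
    rw [Fintype.card_ulift, Fintype.card_fin] at this
    exact this
  rw [← h3, h2]
  simp_rw [h4]
  rfl

theorem uniformValue_mul (hF : IsInformationLoss F) (m n : ℕ) (hm : 0 < m) (hn : 0 < n) :
    uniformValue F (m * n) = uniformValue F m + uniformValue F n := by
  have : Nonempty (ULift.{u} (Fin m)) := ⟨⟨⟨0, hm⟩⟩⟩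
  have h := hF.uniformValue_sum (fun _ : ULift.{u} (Fin m) => n) fun _ => hn
  have hu : ofWeights (fun _ : ULift.{u} (Fin m) => n) (fun _ => hn) = uniform _ := by
    ext x
    have hn' : (n : ℝ) ≠ 0 := by exact_mod_cast hn.ne'
    rw [ofWeights_apply, uniform_apply]
    simp only [Finset.sum_const, Finset.card_univ, smul_eq_mul, Nat.cast_mul]
    field_simp
  rw [← Finset.sum_mul, simplex_sum, one_mul, hu, hF.state_uniform] at h
  simpa using h

theorem uniformValue_nonneg (hF : IsInformationLoss F) (n : ℕ) : 0 ≤ uniformValue F n :=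
  hF.nonneg _

theorem uniformValue_one (hF : IsInformationLoss F) : uniformValue F 1 = 0 := by
  have h := hF.uniformValue_mul 1 1 one_pos one_pos
  rw [mul_one] at h
  linarith

/-- The measure on two points with weights `n + 1` and `1`. -/
def splitOff (n : ℕ) : stdSimplex ℝ (ULift.{u} Bool) :=
  ofWeights (fun b => bif b.down then 1 else n + 1) (by rintro ⟨_ | _⟩ <;> simp)

/-- The blocks have sizes `1` and `n + 1`; the singleton contributes nothing. -/
theorem uniformValue_succ (hF : IsInformationLoss F) (n : ℕ) :
    uniformValue F (n + 2) =
      F (state (splitOff n)) + (n + 1 : ℝ) / (n + 2) * uniformValue F (n + 1) := by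
  have h := hF.uniformValue_sum (fun b : ULift.{u} Bool => bif b.down then 1 else n + 1)
    (by rintro ⟨_ | _⟩ <;> simp)
  have hsum : ∀ {M : Type} [AddCommMonoid M] (f : ULift.{u} Bool → M),
      ∑ b, f b = f ⟨true⟩ + f ⟨false⟩ := by
    intro M _ f
    rw [← Equiv.ulift.symm.sum_comp, Fintype.sum_bool]
    rfl
  rw [hsum, hsum] at h
  simp only [cond_true, cond_false, hF.uniformValue_one, mul_zero, zero_add] at h
  rw [show 1 + (n + 1) = n + 2 by ring] at h
  rw [h, ofWeights_apply, hsum]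
  simp only [cond_true, cond_false]
  push_cast
  rw [show (1 : ℝ) + (n + 1) = n + 2 by ring]
  rfl

theorem tendsto_splitOff (hF : IsInformationLoss F) :
    Tendsto (fun n => F (state (splitOff.{u} n))) atTop (𝓝 0) := by
  classical
  rw [← hF.state_dirac (ULift.up.{u} false)]
  refine hF.state_tendsto (tendsto_subtype_rng.2 (tendsto_pi_nhds.2 ?_))
  have hsum : ∀ n : ℕ, (∑ b : ULift.{u} Bool, (bif b.down then 1 else n + 1)) = n + 2 := by
    intro n
    rw [← Equiv.ulift.symm.sum_comp, Fintype.sum_bool]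
    simp
    ring
  have h0 : Tendsto (fun n : ℕ => (1 : ℝ) / ((n + 2 : ℕ) : ℝ)) atTop (𝓝 0) :=
    (tendsto_add_atTop_iff_nat 2).2 (tendsto_one_div_atTop_nhds_zero_nat (𝕜 := ℝ))
  rintro ⟨_ | _⟩
  · change Tendsto (fun n => splitOff.{u} n ⟨false⟩) atTop (𝓝 (dirac (ULift.up false) ⟨false⟩))
    rw [dirac_apply, if_pos rfl]
    have h1 := h0.const_sub 1
    rw [sub_zero] at h1
    refine h1.congr fun n => ?_
    rw [splitOff, ofWeights_apply, hsum]
    simp only [cond_false]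
    push_cast
    field_simp
    ring
  · change Tendsto (fun n => splitOff.{u} n ⟨true⟩) atTop (𝓝 (dirac (ULift.up false) ⟨true⟩))
    rw [dirac_apply, if_neg (by simp)]
    refine h0.congr fun n => ?_
    rw [splitOff, ofWeights_apply, hsum]
    simp

/-- Non-negativity of `F` allows the factor `(n + 1) / (n + 2)` in the recursion to be replaced by
`1`. -/
theorem uniformValue_le_sum (hF : IsInformationLoss F) (n : ℕ) :
    uniformValue F (n + 1) ≤ ∑ i ∈ Finset.range n, F (state (splitOff.{u} i)) := by
  induction n with
  | zero => simp [hF.uniformValue_one]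
  | succ n ih =>
    rw [Finset.sum_range_succ, hF.uniformValue_succ]
    have h1 : (n + 1 : ℝ) / (n + 2) ≤ 1 := by
      rw [div_le_one (by positivity)]
      linarith
    have h2 := mul_le_of_le_one_left (hF.uniformValue_nonneg (n + 1)) h1
    linarith

/-- By the recursion the difference is the `splitOff` term minus `uniformValue F (n + 1) / (n + 2)`.
The former tends to zero, and the latter is dominated by the Cesàro means of such terms. -/
theorem tendsto_uniformValue_sub (hF : IsInformationLoss F) :
    Tendsto (fun n => uniformValue F (n + 1) - uniformValue F n) atTop (𝓝 0) := by
  have hces := hF.tendsto_splitOff.cesaro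
  have h1 : Tendsto (fun n : ℕ => uniformValue F (n + 1) / (n + 2)) atTop (𝓝 0) := by
    refine tendsto_of_tendsto_of_tendsto_of_le_of_le' tendsto_const_nhds hces ?_ ?_
    · exact Eventually.of_forall fun n => div_nonneg (hF.uniformValue_nonneg _) (by positivity)
    · filter_upwards [eventually_gt_atTop 0] with n hn
      have hn' : (0 : ℝ) < n := by exact_mod_cast hn
      rw [div_eq_inv_mul]
      refine mul_le_mul ?_ (hF.uniformValue_le_sum n) (hF.uniformValue_nonneg _) (by positivity)
      exact inv_anti₀ hn' (by linarith)
  have h2 := hF.tendsto_splitOff.sub h1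
  rw [sub_zero] at h2
  refine (tendsto_add_atTop_iff_nat 1).1 (h2.congr fun n => ?_)
  rw [hF.uniformValue_succ]
  field_simp
  ring

theorem state_eq (hF : IsInformationLoss F) {X : Type u} [Fintype X] (s : stdSimplex ℝ X) :
    F (state s) = uniformValue F 2 / log 2 * shannonEntropy s := by
  have hlog : ∀ n, 0 < n → uniformValue F n = uniformValue F 2 / log 2 * log n := fun n hn =>
    additive_eq_log hF.uniformValue_mul hF.tendsto_uniformValue_sub hn
  have hne : Nonempty X := by
    by_contra h
    rw [not_nonempty_iff] at h
    have := simplex_sum s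
    rw [Fintype.sum_empty] at this
    exact zero_ne_one this
  have hrat : ∀ (a : X → ℕ) (ha : ∀ x, 0 < a x), F (state (ofWeights a ha)) =
      uniformValue F 2 / log 2 * shannonEntropy (ofWeights a ha) := by
    intro a ha
    have h1 := hF.uniformValue_sum a ha
    have h2 : ∀ x, uniformValue F (a x) = uniformValue F 2 / log 2 * log (a x) := fun x =>
      hlog _ (ha x)
    rw [hlog _ (Finset.sum_pos (fun y _ => ha y) Finset.univ_nonempty), log_sum_eq a ha] at h1
    simp_rw [h2, mul_left_comm] at h1
    rw [← Finset.mul_sum, mul_add] at h1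
    linarith
  obtain ⟨a, ha, hlim⟩ := exists_tendsto_ofWeights s
  -- Both sides are continuous and agree on the approximating integral weights.
  refine tendsto_nhds_unique (hF.state_tendsto hlim) ?_
  simp_rw [hrat]
  exact (tendsto_shannonEntropy hlim).const_mul _

theorem eq_mul_condEntropy (hF : IsInformationLoss F) {A B : FinPS.{u}} (f : A ⟶ B) :
    F f = uniformValue F 2 / log 2 * condEntropy f := by
  rw [hF.eq_sum_state, condEntropy, Finset.mul_sum]
  refine Finset.sum_congr rfl fun x _ => ?_
  rw [hF.state_eq]
  ring

end IsInformationLoss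

end FinPS

end

theorem theorem7p2 :
    (∀ F : FinPS.MorphismFunction.{u},
      FinPS.Nonnegative F → FinPS.SemiFunctorial F → FinPS.ConvexLinear F →
      FinPS.SeqContinuous F → FinPS.VanishesOnShriek F →
      ∃ c : ℝ, 0 ≤ c ∧ ∀ (A B : FinPS.{u}) (f : A ⟶ B), F f = c * FinPS.condEntropy f) ∧
    (FinPS.Nonnegative FinPS.condEntropy.{u} ∧ FinPS.SemiFunctorial FinPS.condEntropy.{u} ∧
      FinPS.ConvexLinear FinPS.condEntropy.{u} ∧ FinPS.SeqContinuous FinPS.condEntropy.{u} ∧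
      FinPS.VanishesOnShriek FinPS.condEntropy.{u}) := by
  refine ⟨fun F h1 h2 h3 h4 h5 => ?_, FinPS.condEntropy_nonnegative,
    FinPS.condEntropy_semiFunctorial, FinPS.condEntropy_convexLinear,
    FinPS.condEntropy_seqContinuous, FinPS.condEntropy_vanishesOnShriek⟩
  have hF : FinPS.IsInformationLoss F := ⟨h1, h2, h3, h4, h5⟩
  exact ⟨FinPS.uniformValue F 2 / Real.log 2,
    div_nonneg (hF.uniformValue_nonneg 2) (Real.log_nonneg one_le_two),
    fun A B f => hF.eq_mul_condEntropy f⟩
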